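/- \textbf{Sets of tiles and tilings.} Let $X$ be a Riemannian manifold with distance $d$. A \emph{set of tiles} for $X$ is a triple $(\mathcal T,\mathcal W,o)$, where $\mathcal T$ is a finite collection of tiles (compact connected subsets of $X$ with nonempty interior), each with a finite family of distinguished closed connected nonempty subsets (faces; two faces of a tile may have the same underlying set), $\mathcal W$ is the finite collection of kinds of faces (faces of the same kind are isometric), and $o\colon\mathcal W\to\mathcal W$ is an opposition function. A \emph{tiling} of $X$ by $(\mathcal T,\mathcal W,o)$ is a cover $X=\bigcup_\alpha X_\alpha$ by pieces isometric to tiles, such that every nonempty intersection of two distinct pieces is identified, by the isometries, with a face $w_\alpha$ of the tile of $X_\alpha$ and a face $w_\beta$ of the tile of $X_\beta$ whose kinds satisfy $o(w_\alpha)=w_\beta$ and $o(w_\beta)=w_\alpha$. An isometry of $X$ \emph{preserves} the tiling if it permutes the pieces, respecting their tiles and the kinds of the faces identified with their intersections. A tiling is \emph{aperiodic} if no group acting cocompactly on $X$ by isometries preserves it; an \emph{aperiodic set of tiles} is a set of tiles that admits a tiling of $X$ and all of whose tilings are aperiodic. \textbf{Setting.} Let $M$ be a compact (finite-dimensional, smooth)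 Riemannian manifold and $\widetilde M\to M$ a regular covering, with $\widetilde M$ a connected Riemannian manifold with the lifted metric $\widetilde d$, whose covering group $G$ is infinite and finitely generated and acts by deck transformations. Fix $x_0\in\widetilde M$ and let $$D=\{x\in\widetilde M:\ \widetilde d(x,x_0)\le\widetilde d(x,g x_0)\ \text{for all } g\in G\},\qquad W_g=D\cap gD,\qquad S=\{g\ne1: W_g\neq\emptyset\}.$$ Regard $D$ as a single tile with faces $W_s$, $s\in S$, each its own kind, and $o(W_s)=W_{s^{-1}}$. Assume the \emph{grid condition}: the faces $W_s$ are connected, and the tiling of $\widetilde M$ by translates of $D$ is unique, i.e. for every tiling of $\widetilde M$ by this tile there is an isometry $u$ of $\widetilde M$ such that the pieces are the (pairwise distinct) sets $u(gD)$, $g\in G$, and whenever $u(gD)$ and $u(hD)$ are distinct and meet, the intersection is identified with the face $W_{g^{-1}h}$ of the tile of $u(gD)$. \textbf{Decorated tiles.} Let $p\ge1$ be an integer. An edge chain is a function $\psi\colon G\times G\to\mathbb Z_p$ with $\psi(g,h)=0$ unless $g\neq h$ and $gD\cap hD\ne\emptyset$; its boundary is $(\partial\psi)(g)=\sum_{h}(\psi(h,g)-\psi(g,h))$.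 The set of tiles $\mathcal T_\psi$ consists of the translates $gD$ of $D$ (moved back to $D$), where the face $W_s$ towards $gsD$ is decorated with $\psi(g,gs)$ bumps and $\psi(gs,g)$ indentations; two translates with equal decorations give the same tile. The kind of a face is determined by $s$ and the two numbers, and the face $W_s$ with $a$ bumps and $b$ indentations is opposite to $W_{s^{-1}}$ with $b$ bumps and $a$ indentations. \textbf{Theorem.} There is an edge chain $\psi$ with $\partial\psi=\sum_{g\in G}g$. For every such $\psi$: \begin{enumerate} \item If a group $\Gamma$ of isometries of $\widetilde M$ acts cocompactly and preserves a tiling of $\widetilde M$ by $\mathcal T_\psi$, then there are an isometry $u$ of $\widetilde M$ and a finite-index subgroup $G'\le G$ with $[G:G']\equiv0 \pmod p$ such that the pieces of the tiling are the sets $u(gD)$, $g\in G$, and $\Gamma$ acts on them as $G'$ does by left translations: for each $\gamma\in\Gamma$ there is $k\in G'$, and for each $k\in G'$ there is $\gamma\in\Gamma$, with $\gamma(u(gD))=u(kgD)$ for all $g\in G$. \item If $p$ does not divide the index $[G:G']$ of any finite-index subgroup $G'\le G$, then $\mathcal T_\psi$ is an aperiodic set of tiles of $\widetilde M$. In particular,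 $\widetilde M$ admits an aperiodic set of tiles. \end{enumerate} -/

import Mathlib

open scoped Manifold ContDiff Pointwise Bundle

universe u v

/-! ### Sets of tiles and tilings -/

/-- The raw data `(𝒯, 𝒲, o)` of a set of tiles for a space `X`.  Each tile is (up to isometry) a
subset of `X`, and each face belongs to a tile and is a subset of that tile.  Congruent faces that
carry the same matching pattern (for instance the same bumps and indentations) are identified: they
have the same `kind`, and the opposition function is defined on the kinds of faces. Different faces
of one tile may have the same underlying set: e.g. several tiles may touch a given tile exactly in
one common corner, and each of them corresponds to a face of its own. -/
structure TileData (X : Type u) where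
  Tile : Type v
  Face : Type v
  Kind : Type v
  shape : Tile → Set X
  tileOf : Face → Tile
  carrier : Face → Set X
  kind : Face → Kind
  opp : Kind → Kind

/-- `𝒯` is a set of tiles for `X`: there are finitely many tiles, with finitely many faces. The
tiles are compact and connected with nonempty interior, the faces are closed, connected (in
particular nonempty) subsets of their tiles, and faces of the same kind are congruent. -/
structure TileData.IsSetOfTiles {X : Type u} [MetricSpace X] (𝒯 : TileData.{u, v} X) : Prop where
  finite_tile : Finite 𝒯.Tile
  finite_face : Finite 𝒯.Face
  finite_kind : Finite 𝒯.Kind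
  isCompact_shape : ∀ t, IsCompact (𝒯.shape t)
  isConnected_shape : ∀ t, IsConnected (𝒯.shape t)
  nonempty_interior_shape : ∀ t, (interior (𝒯.shape t)).Nonempty
  isClosed_carrier : ∀ f, IsClosed (𝒯.carrier f)
  isConnected_carrier : ∀ f, IsConnected (𝒯.carrier f)
  carrier_subset : ∀ f, 𝒯.carrier f ⊆ 𝒯.shape (𝒯.tileOf f)
  congruent_of_kind_eq : ∀ f f', 𝒯.kind f = 𝒯.kind f' →
    Nonempty (𝒯.carrier f ≃ᵢ 𝒯.carrier f')

/-- A tiling of `X` by the tiles of `𝒯`: a family of subsets (pieces) covering `X`, each of which is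
isometric to a tile. Every nonempty intersection of two distinct pieces `P`, `Q` is identified with a
face `face P Q` of the tile of `P` and a face `face Q P` of the tile of `Q`, and the kinds of
these two faces are opposite. -/
structure Tiling {X : Type u} [MetricSpace X] (𝒯 : TileData.{u, v} X) where
  pieces : Set (Set X)
  sUnion_pieces : ⋃₀ pieces = Set.univ
  tile : pieces → 𝒯.Tile
  face : ∀ P Q : pieces, P ≠ Q → ((P : Set X) ∩ Q).Nonempty → 𝒯.Face
  tileOf_face : ∀ P Q hne hPQ, 𝒯.tileOf (face P Q hne hPQ) = tile P
  /-- One isometry from the tile onto the piece realizes all the identifications of faces. -/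
  isometric : ∀ P : pieces, ∃ φ : 𝒯.shape (tile P) ≃ᵢ (P : Set X), ∀ Q hne hPQ,
    {x : X | ∃ y : 𝒯.shape (tile P), (y : X) ∈ 𝒯.carrier (face P Q hne hPQ) ∧ (φ y : X) = x} =
      (P : Set X) ∩ Q
  opp_face : ∀ P Q hne hPQ hne' hQP,
    𝒯.opp (𝒯.kind (face P Q hne hPQ)) = 𝒯.kind (face Q P hne' hQP)

/-- The isometry `γ` of `X` preserves the tiling `T`: it permutes the pieces, so that every piece is
sent to a piece with the same tile, and intersections of pieces are sent to intersections of
pieces that are identified with faces of the same kind. -/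
def Tiling.IsPreservedBy {X : Type u} [MetricSpace X] {𝒯 : TileData.{u, v} X} (T : Tiling 𝒯)
    (γ : X ≃ᵢ X) : Prop :=
  ∃ σ : Equiv.Perm T.pieces,
    (∀ P, (σ P : Set X) = γ '' P) ∧
    (∀ P, T.tile (σ P) = T.tile P) ∧
    ∀ P Q hne hPQ hne' hPQ',
      𝒯.kind (T.face (σ P) (σ Q) hne' hPQ') = 𝒯.kind (T.face P Q hne hPQ)

/-- A group of isometries of `X` acts cocompactly: the translates of some compact set cover `X`. -/
def ActsCocompactly {X : Type u} [MetricSpace X] (Γ : Subgroup (X ≃ᵢ X)) : Prop :=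
  ∃ K : Set X, IsCompact K ∧ ∀ x : X, ∃ γ ∈ Γ, γ x ∈ K

/-- A tiling of `X` is (weakly) aperiodic if no group acting on `X` cocompactly by isometries
preserves it. -/
def Tiling.IsAperiodic {X : Type u} [MetricSpace X] {𝒯 : TileData.{u, v} X} (T : Tiling 𝒯) : Prop :=
  ¬ ∃ Γ : Subgroup (X ≃ᵢ X), ActsCocompactly Γ ∧ ∀ γ ∈ Γ, T.IsPreservedBy γ

/-- An aperiodic set of tiles of `X`: a set of tiles that admits tilings of `X`, all of which are
aperiodic. -/
structure TileData.IsAperiodic {X : Type u} [MetricSpace X] (𝒯 : TileData.{u, v} X) : Prop where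
  isSetOfTiles : 𝒯.IsSetOfTiles
  nonempty_tiling : Nonempty (Tiling 𝒯)
  isAperiodic : ∀ T : Tiling 𝒯, T.IsAperiodic

/-! ### Regular covers and Dirichlet domains -/

/-- `q : X → M` is a regular covering with covering group `G`, and the metric of `X` is lifted
from that of `M` (the covering is a local isometry). -/
structure IsRegularMetricCovering (G : Type v) {X M : Type*} [Group G] [MetricSpace X]
    [MetricSpace M] [MulAction G X] (q : X → M) : Prop where
  isCoveringMap : IsCoveringMap q
  surjective : Function.Surjective q
  local_isometry : ∀ x, ∃ U ∈ nhds x, ∀ y ∈ U, ∀ z ∈ U, dist (q y) (q z) = dist y z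
  continuous_smul : ∀ g : G, Continuous fun x : X => g • x
  faithful : ∀ g : G, (∀ x : X, g • x = x) → g = 1
  map_smul : ∀ (g : G) (x : X), q (g • x) = q x
  transitive : ∀ x y : X, q x = q y → ∃ g : G, g • x = y

section Dirichlet

variable (G : Type v) {X : Type u} [Group G] [MetricSpace X] [MulAction G X] (x₀ : X)

/-- The Dirichlet domain of the action of `G` on `X`, centred at `x₀`. -/
def dirichletDomain : Set X :=
  {x | ∀ g : G, dist x x₀ ≤ dist x (g • x₀)}

/-- The face `W_g = D ∩ g D` of the Dirichlet domain. -/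
def dirichletFace (g : G) : Set X :=
  dirichletDomain G x₀ ∩ g • dirichletDomain G x₀

/-- The set of those `g ≠ 1` for which the face `W_g` is nonempty. -/
def faceSet : Set G :=
  {g | g ≠ 1 ∧ (dirichletFace G x₀ g).Nonempty}

variable {G x₀} in
theorem inv_mem_faceSet {g : G} (hg : g ∈ faceSet G x₀) : g⁻¹ ∈ faceSet G x₀ := by
  obtain ⟨h1, x, hx, hx'⟩ := hg
  refine ⟨inv_ne_one.mpr h1, g⁻¹ • x, ?_, Set.smul_mem_smul_set hx⟩
  exact Set.mem_smul_set_iff_inv_smul_mem.mp hx'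

/-- The undecorated Dirichlet domain `D` as a single tile with the faces `W_s`, where the face `W_s`
is opposite to the face `W_{s⁻¹}` (since `s W_{s⁻¹} = W_s`). -/
def dirichletTile : TileData.{u, v} X where
  Tile := PUnit
  Face := faceSet G x₀
  Kind := faceSet G x₀
  shape _ := dirichletDomain G x₀
  tileOf _ := PUnit.unit
  carrier s := dirichletFace G x₀ s
  kind s := s
  opp s := ⟨(s : G)⁻¹, inv_mem_faceSet s.2⟩

/-- A tiling of `X` by the tile `D` is, up to the isometry `u` of `X`, the tiling by translates
of `D`: its pieces are the sets `u (g D)`, and the intersection of the pieces of `g` and `h` is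
identified with the face `W_{g⁻¹h}` of `D`. -/
def Tiling.IsTranslateTiling {G : Type v} {X : Type u} [Group G] [MetricSpace X] [MulAction G X]
    {x₀ : X} (T : Tiling (dirichletTile G x₀)) (u : X ≃ᵢ X) : Prop :=
  ∃ e : G ≃ T.pieces,
    (∀ g, (e g : Set X) = u '' (g • dirichletDomain G x₀)) ∧
    ∀ g h hne hgh, (T.face (e g) (e h) hne hgh : faceSet G x₀).1 = g⁻¹ * h

/-- The grid condition: `D` with the faces `W_s` is a legitimate tile (that is, its faces are
connected), and up to isometries of `X` the tiling by translates of `D` is the only tiling of `X`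
by the tile `D`. -/
structure GridCondition : Prop where
  isConnected_face : ∀ s ∈ faceSet G x₀, IsConnected (dirichletFace G x₀ s)
  unique : ∀ T : Tiling (dirichletTile G x₀), ∃ u : X ≃ᵢ X, T.IsTranslateTiling u

end Dirichlet

/-! ### Chains and the decorated tiles -/

/-- The boundary of a `1`-chain `ψ = ∑ ψ x y [x, y]`, with `∂ [x, y] = y - x`. -/
noncomputable def chainBoundary {G : Type v} {A : Type*} [AddCommGroup A] (ψ : G → G → A) (x : G) :
    A :=
  ∑ᶠ y, (ψ y x - ψ x y)

/-- The chain `ψ` is supported on the oriented edges of the graph with vertex set `G` in which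
distinct `g`, `h` are joined when the translates `g D` and `h D` of the Dirichlet domain meet. (This
is the Cayley graph of `G` with respect to `faceSet G x₀`.) -/
def IsEdgeChain {G : Type v} {X : Type u} [Group G] [MetricSpace X] [MulAction G X] (x₀ : X)
    {A : Type*} [AddCommGroup A] (ψ : G → G → A) : Prop :=
  ∀ g h, ψ g h ≠ 0 → g ≠ h ∧
    ((g • dirichletDomain G x₀) ∩ (h • dirichletDomain G x₀)).Nonempty

/-- The decoration of `D` obtained from the translate `g D`: on the face towards `g s D` there are
`ψ g (g s)` bumps and `ψ (g s) g` indentations. -/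
def decoration {G : Type v} {X : Type u} [Group G] [MetricSpace X] [MulAction G X] (x₀ : X) {p : ℕ}
    (ψ : G → G → ZMod p) (g : G) : faceSet G x₀ → ZMod p × ZMod p :=
  fun s => (ψ g (g * s), ψ (g * s) g)

/-- The set of tiles obtained by decorating the translates of `D` by bumps and indentations
according to the chain `ψ`. The tiles are the copies of `D`, one for each decoration that
occurs, with the faces `W_s`. A face `W_s` with `a` bumps and `b` indentations is opposite to a
face `W_{s⁻¹}` with `b` bumps and `a` indentations. -/
def decoratedTiles {G : Type v} {X : Type u} [Group G] [MetricSpace X] [MulAction G X] (x₀ : X)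
    {p : ℕ} (ψ : G → G → ZMod p) : TileData.{u, v} X where
  Tile := Set.range (decoration x₀ ψ)
  Face := Set.range (decoration x₀ ψ) × faceSet G x₀
  Kind := faceSet G x₀ × ZMod p × ZMod p
  shape _ := dirichletDomain G x₀
  tileOf f := f.1
  carrier f := dirichletFace G x₀ f.2
  kind f := (f.2, f.1.1 f.2)
  opp k := (⟨(k.1 : G)⁻¹, inv_mem_faceSet k.1.2⟩, k.2.2, k.2.1)

/-!
The Dirichlet domain `D` tiles `X` by its translates `g D`, and the graph on `G` whose edges join
translates that meet is the Cayley graph of `G` with respect to `faceSet G x₀`.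

*Geometry.* A Riemannian manifold is a length space, and this is the only property of the Riemannian
metric that is used. Since paths can be cut into short pieces, deck transformations, which are local
isometries, are isometries (`IsRegularMetricCovering.isIsometricSMul`); since `M` is compact, all
balls of some fixed radius in `X` are compact, and a Hopf-Rinow argument makes `X` proper
(`IsRegularMetricCovering.properSpace`). Hence the orbit of `x₀` is a free, locally finite net, the
domain `D` is compact, connected and has nonempty interior, and only finitely many translates of `D`
meet it. As `X` is connected, the Cayley graph is connected (`IsUniformOrbit.closure_faceSet`).

*Existence of `ψ`.* In an infinite, connected, locally finite graph every `0`-chain with finite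
coefficients is a boundary: on a finite set of vertices it is the boundary of a sum of walks from a
vertex outside of that set, and compactness does the rest (`SimpleGraph.exists_chainBoundary_eq`).

*Symmetries.* By the grid condition the pieces of a tiling by decorated tiles are the sets `u (g D)`,
and its faces carry the labels of the edges of the Cayley graph. A symmetry of the tiling preserves
these labels; the labels generate `G`, so that the symmetry is a left translation
(`Tiling.IsIndexedBy.exists_forall_image_eq`). The translations that occur form a subgroup `G'`, of
finite index by cocompactness (`IsUniformOrbit.finiteIndex_translationSubgroup`). The bumps and
indentations of the tiling form a `G'`-invariant chain with boundary `1` at each vertex, since every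
tile looks like one of the tiles of `ψ` (`Tiling.IsIndexedBy.sum_tile_sub_eq`). This chain descends
to the finite quotient graph, where the sum of the boundary over all `[G : G']` vertices is zero, so
that `p` divides `[G : G']` (`Subgroup.index_nsmul_eq_zero_of_boundary_eq`).
-/

/-! ### Length spaces -/

/-- A metric space in which the distance is the infimum of the lengths of paths. The length of a
path is encoded by an upper bound `ℓ` for its arc length function, so that no notion of length or
rectifiability is needed. -/
def IsLengthSpace (X : Type*) [MetricSpace X] : Prop :=
  ∀ (x y : X) (L : ℝ), dist x y < L → ∃ (γ : Path x y) (ℓ : unitInterval → ℝ),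
    (∀ s t, s ≤ t → dist (γ s) (γ t) ≤ ℓ t - ℓ s) ∧ ℓ 1 - ℓ 0 ≤ L

theorem IsRiemannianManifold.isLengthSpace
    {E : Type*} [NormedAddCommGroup E] [NormedSpace ℝ E]
    {H : Type*} [TopologicalSpace H] (I : ModelWithCorners ℝ E H)
    {X : Type*} [MetricSpace X] [ChartedSpace H X]
    [Bundle.RiemannianBundle (fun x : X => TangentSpace I x)]
    [IsRiemannianManifold I X] : IsLengthSpace X := by
  intro x y L hL
  have h0 : Manifold.riemannianEDist I x y < ENNReal.ofReal L := by
    rw [← IsRiemannianManifold.out (I := I) x y, edist_dist]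
    exact (ENNReal.ofReal_lt_ofReal_iff (dist_nonneg.trans_lt hL)).2 hL
  obtain ⟨γ, hγ0, hγ1, hγ, hlen⟩ := Manifold.exists_lt_of_riemannianEDist_lt h0
  have hfin : ∀ t : unitInterval, Manifold.pathELength I γ 0 t ≠ ⊤ := fun t =>
    ne_top_of_lt ((Manifold.pathELength_mono le_rfl t.2.2).trans_lt hlen)
  refine ⟨⟨⟨fun t => γ t, ?_⟩, by simpa using hγ0, by simpa using hγ1⟩,
    fun t => (Manifold.pathELength I γ 0 t).toReal, ?_, ?_⟩
  · exact continuousOn_iff_continuous_domRestrict.1 hγ.continuousOn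
  · intro s t hst
    have hst' : (s : ℝ) ≤ t := hst
    have hadd := Manifold.pathELength_add (I := I) (γ := γ) s.2.1 hst'
    have h2 : Manifold.pathELength I γ s t ≠ ⊤ := by
      intro h; apply hfin t; rw [← hadd, h]; simp
    have h1 : edist (γ s) (γ t) ≤ Manifold.pathELength I γ s t := by
      rw [IsRiemannianManifold.out (I := I) (γ s) (γ t)]
      exact Manifold.riemannianEDist_le_pathELength
        (hγ.mono (Set.Icc_subset_Icc s.2.1 t.2.2)) rfl rfl hst'
    have h3 : dist (γ s) (γ t) ≤ (Manifold.pathELength I γ s t).toReal := by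
      rw [dist_edist]; exact ENNReal.toReal_mono h2 h1
    change dist (γ s) (γ t) ≤
      (Manifold.pathELength I γ 0 t).toReal - (Manifold.pathELength I γ 0 s).toReal
    rw [← hadd, ENNReal.toReal_add (hfin s) h2]
    simpa using h3
  · have h := ENNReal.toReal_mono ENNReal.ofReal_ne_top hlen.le
    rw [ENNReal.toReal_ofReal (dist_nonneg.trans hL.le)] at h
    have h' : 0 ≤ (Manifold.pathELength I γ 0 ((0 : unitInterval) : ℝ)).toReal :=
      ENNReal.toReal_nonneg
    simp only [Set.Icc.coe_one] at *
    linarith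

namespace IsLengthSpace

variable {X : Type*} [MetricSpace X]

theorem pathConnectedSpace [Nonempty X] (hX : IsLengthSpace X) : PathConnectedSpace X where
  nonempty := inferInstance
  joined x y := by
    obtain ⟨γ, -⟩ := hX x y (dist x y + 1) (by linarith)
    exact ⟨γ⟩

/-- A map that preserves distances locally does not increase distances globally: a path is cut
into pieces on which the map is isometric. -/
theorem dist_map_le_of_locally_isometric (hX : IsLengthSpace X) {Y : Type*} [MetricSpace Y]
    {f : X → Y} (hf : ∀ x, ∃ U ∈ nhds x, ∀ y ∈ U, ∀ z ∈ U, dist (f y) (f z) = dist y z) (x y : X) :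
    dist (f x) (f y) ≤ dist x y := by
  refine le_of_forall_gt_imp_ge_of_dense fun L hL => ?_
  obtain ⟨γ, ℓ, hℓ, hL'⟩ := hX x y L hL
  refine le_trans ?_ hL'
  choose U hU hUf using hf
  obtain ⟨t, ht0, htm, ⟨n, htn⟩, hts⟩ := exists_monotone_Icc_subset_open_cover_unitInterval
    (c := fun x => γ ⁻¹' interior (U x)) (fun x => isOpen_interior.preimage γ.continuous)
    (fun s _ => Set.mem_iUnion.2 ⟨γ s, mem_interior_iff_mem_nhds.2 (hU _)⟩)
  have key : ∀ k, dist (f x) (f (γ (t k))) ≤ ℓ (t k) - ℓ 0 := by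
    intro k
    induction k with
    | zero => simp [ht0]
    | succ k ih =>
      obtain ⟨i, hi⟩ := hts k
      have hk : t k ≤ t (k + 1) := htm k.le_succ
      have h1 := interior_subset (hi (Set.left_mem_Icc.2 hk))
      have h2 := interior_subset (hi (Set.right_mem_Icc.2 hk))
      calc dist (f x) (f (γ (t (k + 1))))
          ≤ dist (f x) (f (γ (t k))) + dist (f (γ (t k))) (f (γ (t (k + 1)))) :=
            dist_triangle _ _ _
        _ ≤ (ℓ (t k) - ℓ 0) + (ℓ (t (k + 1)) - ℓ (t k)) := by
            rw [hUf i _ h1 _ h2]; exact add_le_add ih (hℓ _ _ hk)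
        _ = _ := by ring
  simpa [htn n le_rfl] using key n

theorem exists_dist_eq_and_dist_lt (hX : IsLengthSpace X) {x y : X} {t ε : ℝ} (ht0 : 0 ≤ t)
    (ht : t ≤ dist x y) (hε : 0 < ε) : ∃ z, dist x z = t ∧ dist z y < dist x y - t + ε := by
  obtain ⟨γ, ℓ, hℓ, hL'⟩ := hX x y (dist x y + ε / 2) (by linarith)
  have hc : Continuous fun s => dist x (γ s) := by fun_prop
  obtain ⟨s, hs⟩ : t ∈ Set.range fun s => dist x (γ s) :=
    mem_range_of_exists_le_of_exists_ge hc ⟨0, by simpa using ht0⟩ ⟨1, by simpa using ht⟩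
  refine ⟨γ s, hs, ?_⟩
  have h1 := hℓ 0 s s.2.1
  have h2 := hℓ s 1 s.2.2
  simp only [Path.source, Path.target] at h1 h2 hs
  linarith

/-- A length space in which all balls of one fixed radius are compact is proper. -/
theorem properSpace (hX : IsLengthSpace X) {r : ℝ} (hr : 0 < r)
    (hc : ∀ x : X, IsCompact (Metric.closedBall x r)) : ProperSpace X := by
  have key : ∀ (n : ℕ) (x : X), IsCompact (Metric.closedBall x (n * (r / 4))) := by
    intro n
    induction n with
    | zero => intro x; simp
    | succ n ih =>
      intro x
      -- a finite `r / 4`-net of the smaller ball gives finitely many balls covering the larger one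
      obtain ⟨F, hF, hcov⟩ := (Metric.totallyBounded_iff.1 (ih x).totallyBounded) (r / 4)
        (by positivity)
      refine (hF.isCompact_biUnion fun y _ => hc y).of_isClosed_subset Metric.isClosed_closedBall ?_
      intro z hz
      rw [Metric.mem_closedBall'] at hz
      push_cast at hz
      obtain ⟨w, hw, hwz⟩ : ∃ w, dist x w ≤ n * (r / 4) ∧ dist w z < r / 2 := by
        have h0 : (0 : ℝ) ≤ n * (r / 4) := by positivity
        rcases le_total (n * (r / 4)) (dist x z) with h | h
        · obtain ⟨w, hw, hwz⟩ := hX.exists_dist_eq_and_dist_lt h0 h (ε := r / 4) (by positivity)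
          exact ⟨w, hw.le, by linarith⟩
        · exact ⟨z, h, by simpa using by positivity⟩
      obtain ⟨y, hy, hwy⟩ := Set.mem_iUnion₂.1 (hcov (Metric.mem_closedBall'.2 hw))
      refine Set.mem_iUnion₂.2 ⟨y, hy, ?_⟩
      rw [Metric.mem_ball] at hwy
      rw [Metric.mem_closedBall]
      linarith [dist_triangle_left z y w]
  refine ⟨fun x ρ => ?_⟩
  obtain ⟨n, hn⟩ := exists_nat_ge (ρ / (r / 4))
  exact (key n x).of_isClosed_subset Metric.isClosed_closedBall
    (Metric.closedBall_subset_closedBall ((div_le_iff₀ (by positivity)).1 hn))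

/-- In a proper length space, every distance can be divided exactly. -/
theorem exists_dist_eq_and_dist_le [ProperSpace X] (hX : IsLengthSpace X) {x y : X} {t : ℝ}
    (ht0 : 0 ≤ t) (ht : t ≤ dist x y) : ∃ z, dist x z = t ∧ dist z y ≤ dist x y - t := by
  obtain ⟨z₀, hz₀, -⟩ := hX.exists_dist_eq_and_dist_lt ht0 ht one_pos
  obtain ⟨z, hz, hmin⟩ := (isCompact_sphere x t).exists_isMinOn (f := fun z => dist z y)
    ⟨z₀, by simpa [dist_comm] using hz₀⟩ (by fun_prop)
  refine ⟨z, by simpa [dist_comm] using hz, le_of_forall_pos_lt_add fun ε hε => ?_⟩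
  obtain ⟨w, hw, hwy⟩ := hX.exists_dist_eq_and_dist_lt ht0 ht hε
  exact (hmin (by simpa [dist_comm] using hw : w ∈ Metric.sphere x t)).trans_lt hwy

end IsLengthSpace

/-! ### Regular coverings of compact manifolds -/

/-- The orbit of `x₀` is free, meets every ball in a finite set, and is a net in `X`. -/
structure IsUniformOrbit (G : Type v) {X : Type u} [Group G] [MetricSpace X] [MulAction G X]
    (x₀ : X) : Prop where
  free : ∀ g : G, g • x₀ = x₀ → g = 1
  finite_dist_le : ∀ C : ℝ, {g : G | dist x₀ (g • x₀) ≤ C}.Finite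
  exists_dist_le : ∃ R : ℝ, ∀ x : X, ∃ g : G, dist x (g • x₀) ≤ R

namespace IsRegularMetricCovering

variable {G : Type v} {X M : Type*} [Group G] [MetricSpace X] [MetricSpace M] [MulAction G X]
  {q : X → M}

theorem isIsometricSMul (hq : IsRegularMetricCovering G q) (hX : IsLengthSpace X) :
    IsIsometricSMul G X := by
  have key : ∀ (g : G) (x y : X), dist (g • x) (g • y) ≤ dist x y := by
    intro g
    refine hX.dist_map_le_of_locally_isometric fun x => ?_
    obtain ⟨U, hU, hUd⟩ := hq.local_isometry x
    obtain ⟨V, hV, hVd⟩ := hq.local_isometry (g • x)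
    refine ⟨U ∩ (fun z => g • z) ⁻¹' V,
      Filter.inter_mem hU ((hq.continuous_smul g).continuousAt hV), fun y hy z hz => ?_⟩
    rw [← hVd _ hy.2 _ hz.2, hq.map_smul, hq.map_smul, hUd _ hy.1 _ hz.1]
  refine ⟨fun g => Isometry.of_dist_eq fun x y => le_antisymm (key g x y) ?_⟩
  simpa using key g⁻¹ (g • x) (g • y)

theorem exists_isCompact_forall_smul_mem [LocallyCompactSpace X] [CompactSpace M]
    (hq : IsRegularMetricCovering G q) :
    ∃ K : Set X, IsCompact K ∧ ∀ x, ∃ g : G, g • x ∈ K := by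
  choose K hK hKx using fun x : X => exists_compact_mem_nhds x
  obtain ⟨t, ht⟩ := isCompact_univ.elim_finite_subcover (fun x => q '' interior (K x))
    (fun x => hq.isCoveringMap.isOpenMap _ isOpen_interior) (fun m _ => by
      obtain ⟨x, rfl⟩ := hq.surjective m
      exact Set.mem_iUnion.2 ⟨x, x, mem_interior_iff_mem_nhds.2 (hKx x), rfl⟩)
  refine ⟨⋃ x ∈ t, K x, t.isCompact_biUnion fun x _ => hK x, fun x => ?_⟩
  obtain ⟨y, hy, z, hz, hzx⟩ := Set.mem_iUnion₂.1 (ht (Set.mem_univ (q x)))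
  obtain ⟨g, rfl⟩ := hq.transitive x z hzx.symm
  exact ⟨g, Set.mem_iUnion₂.2 ⟨y, hy, interior_subset hz⟩⟩

theorem properSpace [LocallyCompactSpace X] [CompactSpace M]
    (hq : IsRegularMetricCovering G q) (hX : IsLengthSpace X) : ProperSpace X := by
  have := hq.isIsometricSMul hX
  obtain ⟨K, hK, hGK⟩ := hq.exists_isCompact_forall_smul_mem
  obtain ⟨r, hr, hc⟩ := hK.exists_isCompact_cthickening
  refine hX.properSpace hr fun x => ?_
  obtain ⟨g, hg⟩ := hGK x
  have h1 : IsCompact (Metric.closedBall (g • x) r) :=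
    hc.of_isClosed_subset Metric.isClosed_closedBall
      (Metric.closedBall_subset_cthickening hg r)
  rw [← Metric.smul_closedBall] at h1
  have h2 := h1.image (hq.continuous_smul g⁻¹)
  rwa [Set.image_smul, inv_smul_smul] at h2

theorem isUniformOrbit [LocallyCompactSpace X] [CompactSpace M]
    (hq : IsRegularMetricCovering G q) (hX : IsLengthSpace X) (x₀ : X) :
    IsUniformOrbit G x₀ := by
  have := hq.isIsometricSMul hX
  have := hq.properSpace hX
  have : Nonempty X := ⟨x₀⟩
  have := hX.pathConnectedSpace
  have free : ∀ g : G, g • x₀ = x₀ → g = 1 := by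
    -- a deck transformation with a fixed point lifts the covering map like the identity
    intro g hg
    refine hq.faithful g fun x => ?_
    exact congrFun (hq.isCoveringMap.eq_of_comp_eq (hq.continuous_smul g) continuous_id
      (funext fun x => hq.map_smul g x) x₀ hg) x
  refine ⟨free, fun C => ?_, ?_⟩
  · have hd : IsDiscrete (q ⁻¹' {q x₀}) := ⟨(hq.isCoveringMap (q x₀)).discreteTopology_fiber⟩
    have hcl : IsClosed (q ⁻¹' {q x₀}) := isClosed_singleton.preimage hq.isCoveringMap.continuous
    have hfin : (Metric.closedBall x₀ C ∩ q ⁻¹' {q x₀}).Finite :=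
      ((isCompact_closedBall x₀ C).inter_right hcl).finite (hd.mono Set.inter_subset_right)
    refine Set.Finite.of_finite_image (f := fun g : G => g • x₀) (hfin.subset ?_) ?_
    · rintro _ ⟨g, hg, rfl⟩
      exact ⟨Metric.mem_closedBall'.2 hg, hq.map_smul g x₀⟩
    · intro g _ h _ hgh
      refine (inv_mul_eq_one.1 (free (g⁻¹ * h) ?_))
      rw [mul_smul, inv_smul_eq_iff]
      exact hgh.symm
  · obtain ⟨K, hK, hGK⟩ := hq.exists_isCompact_forall_smul_mem
    obtain ⟨R, hR⟩ := hK.isBounded.subset_closedBall x₀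
    refine ⟨R, fun x => ?_⟩
    obtain ⟨g, hg⟩ := hGK x
    refine ⟨g⁻¹, ?_⟩
    rw [← dist_smul g, smul_inv_smul]
    exact hR hg

end IsRegularMetricCovering

/-! ### The Dirichlet domain -/

namespace IsUniformOrbit

variable {G : Type v} {X : Type u} [Group G] [MetricSpace X] [MulAction G X] {x₀ : X}

theorem smul_injective (h : IsUniformOrbit G x₀) : Function.Injective fun g : G => g • x₀ := by
  intro g k hgk
  refine inv_mul_eq_one.1 (h.free (g⁻¹ * k) ?_)
  rw [mul_smul, inv_smul_eq_iff]
  exact hgk.symm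

theorem finite_dist_le' (h : IsUniformOrbit G x₀) (x : X) (C : ℝ) :
    {g : G | dist x (g • x₀) ≤ C}.Finite := by
  refine (h.finite_dist_le (dist x x₀ + C)).subset fun g hg => ?_
  exact (dist_triangle_left _ _ x).trans (add_le_add le_rfl hg)

end IsUniformOrbit

section Dirichlet

variable {G : Type v} {X : Type u} [Group G] [MetricSpace X] [MulAction G X] {x₀ : X}

theorem mem_dirichletDomain_self : x₀ ∈ dirichletDomain G x₀ := fun g => by simp

theorem isClosed_dirichletDomain : IsClosed (dirichletDomain G x₀) := by
  have : dirichletDomain G x₀ = ⋂ g : G, {x | dist x x₀ ≤ dist x (g • x₀)} := by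
    ext; simp [dirichletDomain]
  rw [this]
  exact isClosed_iInter fun g => isClosed_le (by fun_prop) (by fun_prop)

theorem smul_mem_smul_dirichletDomain (g : G) : g • x₀ ∈ g • dirichletDomain G x₀ :=
  Set.smul_mem_smul_set mem_dirichletDomain_self

theorem smul_dirichletFace (g s : G) : g • dirichletFace G x₀ s =
    g • dirichletDomain G x₀ ∩ (g * s) • dirichletDomain G x₀ := by
  rw [dirichletFace, Set.smul_set_inter, mul_smul]

theorem IsUniformOrbit.isBounded_dirichletDomain (h : IsUniformOrbit G x₀) :
    Bornology.IsBounded (dirichletDomain G x₀) := by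
  obtain ⟨R, hR⟩ := h.exists_dist_le
  refine (Metric.isBounded_closedBall (x := x₀) (r := R)).subset fun x hx => ?_
  obtain ⟨g, hg⟩ := hR x
  exact (hx g).trans hg

theorem IsUniformOrbit.interior_dirichletDomain_nonempty (h : IsUniformOrbit G x₀) :
    (interior (dirichletDomain G x₀)).Nonempty := by
  obtain ⟨δ, hδ, hmin⟩ : ∃ δ > 0, ∀ g : G, g ≠ 1 → δ ≤ dist x₀ (g • x₀) := by
    have hfin : {g : G | g ≠ 1 ∧ dist x₀ (g • x₀) ≤ 1}.Finite :=
      (h.finite_dist_le 1).subset fun g hg => hg.2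
    rcases Set.eq_empty_or_nonempty {g : G | g ≠ 1 ∧ dist x₀ (g • x₀) ≤ 1} with he | hne
    · refine ⟨1, one_pos, fun g hg => ?_⟩
      by_contra! hlt
      exact (he ▸ (⟨hg, hlt.le⟩ : g ∈ {g : G | g ≠ 1 ∧ dist x₀ (g • x₀) ≤ 1}) : g ∈ (∅ : Set G))
    · obtain ⟨k, hk, hmin⟩ := Set.exists_min_image _ (fun g : G => dist x₀ (g • x₀)) hfin hne
      refine ⟨dist x₀ (k • x₀), dist_pos.2 fun he => hk.1 (h.free k he.symm), fun g hg => ?_⟩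
      rcases le_total (dist x₀ (g • x₀)) 1 with h1 | h1
      · exact hmin g ⟨hg, h1⟩
      · exact hk.2.trans h1
  refine ⟨x₀, mem_interior_iff_mem_nhds.2
    (Filter.mem_of_superset (Metric.ball_mem_nhds x₀ (half_pos hδ)) fun x hx g => ?_)⟩
  rcases eq_or_ne g 1 with rfl | hg
  · simp
  · have h1 := hmin g hg
    have h2 := dist_triangle_left x₀ (g • x₀) x
    rw [Metric.mem_ball] at hx
    linarith

theorem inv_mul_mem_faceSet_iff {g k : G} : g⁻¹ * k ∈ faceSet G x₀ ↔
    g ≠ k ∧ (g • dirichletDomain G x₀ ∩ k • dirichletDomain G x₀).Nonempty := by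
  have h := smul_dirichletFace (x₀ := x₀) g (g⁻¹ * k)
  rw [mul_inv_cancel_left] at h
  rw [← h, Set.smul_set_nonempty, faceSet, Set.mem_ofPred_eq, Ne, inv_mul_eq_one]

theorem IsUniformOrbit.isCompact_dirichletDomain [ProperSpace X] (h : IsUniformOrbit G x₀) :
    IsCompact (dirichletDomain G x₀) :=
  Metric.isCompact_of_isClosed_isBounded isClosed_dirichletDomain h.isBounded_dirichletDomain

/-- The Dirichlet domain is star-shaped with respect to `x₀`; a point of another component that is
nearest to `x₀` could be moved towards `x₀`. -/
theorem IsUniformOrbit.isConnected_dirichletDomain [ProperSpace X] (h : IsUniformOrbit G x₀)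
    (hX : IsLengthSpace X) : IsConnected (dirichletDomain G x₀) := by
  refine ⟨⟨x₀, mem_dirichletDomain_self⟩, ?_⟩
  have main : ∀ A B : Set X, IsClosed A → IsClosed B → dirichletDomain G x₀ ⊆ A ∪ B →
      (dirichletDomain G x₀ ∩ B).Nonempty → x₀ ∈ A →
      (dirichletDomain G x₀ ∩ (A ∩ B)).Nonempty := by
    intro A B hA hB hAB hDB hx₀
    by_contra hne
    have hDBc : IsCompact (dirichletDomain G x₀ ∩ B) := h.isCompact_dirichletDomain.inter_right hB
    have hDAc : IsClosed (dirichletDomain G x₀ ∩ A) := isClosed_dirichletDomain.inter hA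
    obtain ⟨x, hx, hmin⟩ := hDBc.exists_isMinOn (f := fun x => dist x x₀) hDB (by fun_prop)
    have hxA : x ∉ dirichletDomain G x₀ ∩ A := fun hxA => hne ⟨x, hx.1, hxA.2, hx.2⟩
    obtain ⟨δ, hδ, hball⟩ := Metric.isOpen_iff.1 hDAc.isOpen_compl x hxA
    have hpos : 0 < dist x x₀ := dist_pos.2 fun he => hxA ⟨hx.1, he ▸ hx₀⟩
    obtain ⟨z, hz, hz'⟩ := hX.exists_dist_eq_and_dist_le (x := x) (y := x₀)
      (t := min (δ / 2) (dist x x₀)) (by positivity) (min_le_right _ _)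
    have ht : 0 < min (δ / 2) (dist x x₀) := by positivity
    have hzD : z ∈ dirichletDomain G x₀ := fun g => by
      linarith [hx.1 g, dist_triangle x z (g • x₀)]
    have hzA : z ∉ A := fun hzA => by
      refine hball (?_ : z ∈ Metric.ball x δ) ⟨hzD, hzA⟩
      rw [Metric.mem_ball']
      linarith [min_le_left (δ / 2) (dist x x₀)]
    have hzm : dist x x₀ ≤ dist z x₀ := hmin ⟨hzD, (hAB hzD).resolve_left hzA⟩
    linarith
  refine isPreconnected_closed_iff.2 fun A B hA hB hAB hDA hDB => ?_
  rcases hAB mem_dirichletDomain_self with hx | hx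
  · exact main A B hA hB hAB hDB hx
  · rw [Set.inter_comm A B]
    exact main B A hB hA (by rwa [Set.union_comm]) hDA hx

variable [IsIsometricSMul G X]

theorem mem_smul_dirichletDomain {g : G} {x : X} :
    x ∈ g • dirichletDomain G x₀ ↔ ∀ k : G, dist x (g • x₀) ≤ dist x (k • x₀) := by
  rw [Set.mem_smul_set_iff_inv_smul_mem]
  constructor
  · intro h k
    have := h (g⁻¹ * k)
    rw [← dist_smul g, ← dist_smul g (g⁻¹ • x) ((g⁻¹ * k) • x₀)] at this
    simpa [← mul_smul] using this
  · intro h k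
    rw [← dist_smul g, ← dist_smul g (g⁻¹ • x) (k • x₀)]
    simpa [← mul_smul] using h (g * k)

theorem isClosed_smul_dirichletDomain (g : G) : IsClosed (g • dirichletDomain G x₀) :=
  isClosed_dirichletDomain.smul g

theorem isClosed_dirichletFace (s : G) : IsClosed (dirichletFace G x₀ s) :=
  isClosed_dirichletDomain.inter (isClosed_smul_dirichletDomain s)

namespace IsUniformOrbit

theorem smul_dirichletDomain_injective (h : IsUniformOrbit G x₀) :
    Function.Injective fun g : G => g • dirichletDomain G x₀ := by
  intro g k hgk
  have h1 : g • x₀ ∈ k • dirichletDomain G x₀ := by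
    rw [← show g • dirichletDomain G x₀ = k • dirichletDomain G x₀ from hgk]
    exact smul_mem_smul_dirichletDomain g
  have h2 := mem_smul_dirichletDomain.1 h1 g
  rw [dist_self] at h2
  exact h.smul_injective (dist_le_zero.1 h2)

theorem exists_mem_smul_dirichletDomain (h : IsUniformOrbit G x₀) (x : X) :
    ∃ g : G, x ∈ g • dirichletDomain G x₀ := by
  -- the minimum of the distances to the orbit is attained on the finitely many points near `x`
  obtain ⟨g, hg, hmin⟩ := Set.exists_min_image _ (fun g : G => dist x (g • x₀))
    (h.finite_dist_le' x (dist x x₀)) ⟨1, by simp⟩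
  refine ⟨g, mem_smul_dirichletDomain.2 fun k => ?_⟩
  rcases le_total (dist x (k • x₀)) (dist x x₀) with hk | hk
  · exact hmin k hk
  · exact le_trans hg hk

theorem finite_inter_nonempty (h : IsUniformOrbit G x₀) {K : Set X}
    (hK : Bornology.IsBounded K) : {g : G | (K ∩ g • dirichletDomain G x₀).Nonempty}.Finite := by
  obtain ⟨R, hR⟩ := h.exists_dist_le
  obtain ⟨C, hC⟩ := hK.subset_closedBall x₀
  refine (h.finite_dist_le (C + R)).subset ?_
  rintro g ⟨x, hxK, hxg⟩
  obtain ⟨k, hk⟩ := hR x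
  have h1 := (mem_smul_dirichletDomain.1 hxg k).trans hk
  exact (dist_triangle_left _ _ x).trans (add_le_add (hC hxK) h1)

theorem finite_faceSet (h : IsUniformOrbit G x₀) : (faceSet G x₀).Finite :=
  (h.finite_inter_nonempty h.isBounded_dirichletDomain).subset fun _ hg => hg.2

/-- The translates of the Dirichlet domain by a subset of `G` form a locally finite family, so that
their union is closed. -/
theorem isClosed_biUnion_smul_dirichletDomain (h : IsUniformOrbit G x₀) (A : Set G) :
    IsClosed (⋃ g ∈ A, g • dirichletDomain G x₀) := by
  rw [Set.biUnion_eq_iUnion]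
  refine LocallyFinite.isClosed_iUnion (fun x => ⟨Metric.ball x 1, Metric.ball_mem_nhds x one_pos,
    ?_⟩) fun g => isClosed_smul_dirichletDomain g.1
  refine Set.Finite.of_finite_image (f := Subtype.val)
    ((h.finite_inter_nonempty (Metric.isBounded_ball (x := x) (r := 1))).subset ?_)
    Subtype.val_injective.injOn
  rintro _ ⟨g, hg, rfl⟩
  rwa [Set.mem_ofPred_eq, Set.inter_comm]

/-- The set of the neighbours of the Dirichlet domain generates `G`: otherwise the translates by the
generated subgroup and the other translates would disconnect `X`. -/
theorem closure_faceSet [PreconnectedSpace X] (h : IsUniformOrbit G x₀) :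
    Subgroup.closure (faceSet G x₀) = ⊤ := by
  set N := Subgroup.closure (faceSet G x₀) with hN
  refine (Subgroup.eq_top_iff' N).2 fun k => ?_
  by_contra hk
  obtain ⟨x, -, hx1, hx2⟩ := isPreconnected_closed_iff.1 isPreconnected_univ _ _
    (h.isClosed_biUnion_smul_dirichletDomain (N : Set G))
    (h.isClosed_biUnion_smul_dirichletDomain ((N : Set G)ᶜ))
    (fun x _ => by
      obtain ⟨g, hg⟩ := h.exists_mem_smul_dirichletDomain x
      by_cases hgN : g ∈ N
      · exact Or.inl (Set.mem_biUnion hgN hg)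
      · exact Or.inr (Set.mem_biUnion hgN hg))
    ⟨_, trivial, Set.mem_biUnion N.one_mem (smul_mem_smul_dirichletDomain 1)⟩
    ⟨_, trivial, Set.mem_biUnion hk (smul_mem_smul_dirichletDomain k)⟩
  obtain ⟨g, hg, hxg⟩ := Set.mem_iUnion₂.1 hx1
  obtain ⟨g', hg', hxg'⟩ := Set.mem_iUnion₂.1 hx2
  refine hg' ?_
  rcases eq_or_ne g g' with rfl | hne
  · exact hg
  · have hs : g⁻¹ * g' ∈ N :=
      Subgroup.subset_closure (inv_mul_mem_faceSet_iff.2 ⟨hne, x, hxg, hxg'⟩)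
    exact (Subgroup.mul_mem_cancel_left N (N.inv_mem hg)).1 hs

end IsUniformOrbit

end Dirichlet

/-! ### Chains with prescribed boundary -/

namespace SimpleGraph

variable {V : Type*} (Γ : SimpleGraph V) {A : Type*} [AddCommGroup A]

/-- The group of the `1`-chains with values in `A` that are supported on the oriented edges of a
graph. -/
def edgeChains (A : Type*) [AddCommGroup A] : AddSubgroup (V → V → A) where
  carrier := {ψ | ∀ x y, ψ x y ≠ 0 → Γ.Adj x y}
  zero_mem' x y h := absurd rfl h
  add_mem' := by
    intro a b ha hb x y h
    by_contra hn
    exact h (by simp [not_not.1 (mt (ha x y) hn), not_not.1 (mt (hb x y) hn)])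
  neg_mem' := by
    intro a ha x y h
    exact ha x y (by simpa using h)

variable {Γ}

theorem mem_edgeChains {ψ : V → V → A} :
    ψ ∈ Γ.edgeChains A ↔ ∀ x y, ψ x y ≠ 0 → Γ.Adj x y := Iff.rfl

theorem eq_zero_of_mem_edgeChains {ψ : V → V → A} (hψ : ψ ∈ Γ.edgeChains A) {x y : V}
    (h : ¬ Γ.Adj x y) : ψ x y = 0 := not_not.1 (mt (hψ x y) h)

/-- In a locally finite graph the boundary of a chain at a vertex is a finite sum. -/
theorem chainBoundary_eq_sum (hΓ : ∀ x, (Γ.neighborSet x).Finite) {ψ : V → V → A}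
    (hψ : ψ ∈ Γ.edgeChains A) (x : V) :
    chainBoundary ψ x = ∑ y ∈ (hΓ x).toFinset, (ψ y x - ψ x y) := by
  refine finsum_eq_sum_of_support_subset _ fun y hy => ?_
  rw [Set.Finite.coe_toFinset, mem_neighborSet]
  by_contra hn
  refine hy ?_
  simp [eq_zero_of_mem_edgeChains hψ hn, eq_zero_of_mem_edgeChains hψ (mt Γ.adj_symm hn)]

theorem chainBoundary_add (hΓ : ∀ x, (Γ.neighborSet x).Finite) {φ ψ : V → V → A}
    (hφ : φ ∈ Γ.edgeChains A) (hψ : ψ ∈ Γ.edgeChains A) (x : V) :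
    chainBoundary (φ + ψ) x = chainBoundary φ x + chainBoundary ψ x := by
  rw [chainBoundary_eq_sum hΓ hφ, chainBoundary_eq_sum hΓ hψ,
    chainBoundary_eq_sum hΓ (add_mem hφ hψ), ← Finset.sum_add_distrib]
  exact Finset.sum_congr rfl fun y _ => by simp only [Pi.add_apply]; abel

theorem chainBoundary_sum (hΓ : ∀ x, (Γ.neighborSet x).Finite) {ι : Type*} (s : Finset ι)
    {ψ : ι → V → V → A} (hψ : ∀ i, ψ i ∈ Γ.edgeChains A) (x : V) :
    chainBoundary (∑ i ∈ s, ψ i) x = ∑ i ∈ s, chainBoundary (ψ i) x := by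
  classical
  induction s using Finset.induction_on with
  | empty => simp [chainBoundary]
  | insert i s hi ih =>
    rw [Finset.sum_insert hi, Finset.sum_insert hi,
      chainBoundary_add hΓ (hψ i) (sum_mem fun i _ => hψ i), ih]

/-- In a connected graph, `a • (y - x)` is the boundary of a chain, supported on a walk. -/
theorem exists_chainBoundary_eq_single_sub_single [DecidableEq V]
    (hΓ : ∀ x, (Γ.neighborSet x).Finite) (a : A) {x y : V} (w : Γ.Walk x y) :
    ∃ ψ ∈ Γ.edgeChains A, ∀ z, chainBoundary ψ z = (Pi.single y a - Pi.single x a : V → A) z := by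
  induction w with
  | nil => exact ⟨0, zero_mem _, fun z => by simp [chainBoundary]⟩
  | @cons x t y h w ih =>
    obtain ⟨ψ, hψ, hb⟩ := ih
    have he : Pi.single x (Pi.single t a) ∈ Γ.edgeChains A := by
      intro v z hvz
      rcases eq_or_ne v x with rfl | hv
      · rcases eq_or_ne z t with rfl | hz
        · exact h
        · simp [hz] at hvz
      · simp [hv] at hvz
    refine ⟨ψ + Pi.single x (Pi.single t a), add_mem hψ he, fun z => ?_⟩
    have hbe : chainBoundary (Pi.single x (Pi.single t a) : V → V → A) z =
        (Pi.single t a - Pi.single x a : V → A) z := by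
      have hxt : x ≠ t := h.ne
      rw [chainBoundary]
      rcases eq_or_ne z x with rfl | hzx
      · rw [finsum_eq_single _ t (fun v hv => by
          by_cases hvz : v = z
          · subst hvz; simp
          · simp [hv, hvz])]
        simp [hxt, hxt.symm]
      · rw [finsum_eq_single _ x (fun v hv => by simp [hv, hzx])]
        simp [hzx]
    rw [chainBoundary_add hΓ hψ he, hb, hbe]
    simp only [Pi.sub_apply]
    abel

/-- In an infinite connected locally finite graph every `0`-chain with values in a finite group is
the boundary of a `1`-chain. By compactness it is enough to prescribe the boundary on a finite set
of vertices; there it is the boundary of a sum of walks that start at a vertex outside of that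
set. -/
theorem exists_chainBoundary_eq [Infinite V] [Finite A] (hΓ : ∀ x, (Γ.neighborSet x).Finite)
    (hc : Γ.Preconnected) (b : V → A) : ∃ ψ ∈ Γ.edgeChains A, ∀ x, chainBoundary ψ x = b x := by
  classical
  let _ : TopologicalSpace A := ⊥
  have : DiscreteTopology A := ⟨rfl⟩
  let C : Finset V → Set (V → V → A) := fun F =>
    {ψ | ψ ∈ Γ.edgeChains A} ∩ ⋂ x ∈ F, {ψ | ∑ y ∈ (hΓ x).toFinset, (ψ y x - ψ x y) = b x}
  have happ : ∀ x y : V, Continuous fun ψ : V → V → A => ψ x y := fun x y => by fun_prop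
  have hclosed : ∀ F, IsClosed (C F) := by
    intro F
    refine IsClosed.inter ?_ (isClosed_biInter fun x _ => isClosed_eq ?_ continuous_const)
    · have : {ψ : V → V → A | ψ ∈ Γ.edgeChains A} = ⋂ x, ⋂ y, {ψ | ψ x y ≠ 0 → Γ.Adj x y} := by
        ext ψ; simp [mem_edgeChains]
      rw [this]
      exact isClosed_iInter fun x => isClosed_iInter fun y =>
        (isClosed_discrete {a : A | a ≠ 0 → Γ.Adj x y}).preimage (happ x y)
    · exact continuous_finsetSum _ fun y _ => (happ y x).sub (happ x y)
  have hne : ∀ F, (C F).Nonempty := by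
    intro F
    obtain ⟨v, hv⟩ := Infinite.exists_notMem_finset F
    choose ψ hψ hb using fun x : V =>
      exists_chainBoundary_eq_single_sub_single hΓ (b x) (hc v x).some
    have hmem : ∑ x ∈ F, ψ x ∈ Γ.edgeChains A := sum_mem fun x _ => hψ x
    refine ⟨∑ x ∈ F, ψ x, hmem, Set.mem_iInter₂.2 fun x hx => ?_⟩
    have hvx : x ≠ v := fun h => hv (h ▸ hx)
    rw [Set.mem_ofPred_eq, ← chainBoundary_eq_sum hΓ hmem, chainBoundary_sum hΓ F hψ]
    simp [hb, hvx, Pi.single_apply, hx]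
  obtain ⟨ψ, hψ⟩ := IsCompact.nonempty_iInter_of_directed_nonempty_isCompact_isClosed C
    (fun F₁ F₂ => ⟨F₁ ∪ F₂,
      Set.inter_subset_inter_right _ (Set.biInter_mono (fun x hx => Finset.mem_union_left _ hx)
        fun _ _ => subset_rfl),
      Set.inter_subset_inter_right _ (Set.biInter_mono (fun x hx => Finset.mem_union_right _ hx)
        fun _ _ => subset_rfl)⟩)
    hne (fun F => (hclosed F).isCompact) hclosed
  rw [Set.mem_iInter] at hψ
  refine ⟨ψ, (hψ ∅).1, fun x => ?_⟩
  rw [chainBoundary_eq_sum hΓ (hψ ∅).1]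
  exact Set.mem_iInter₂.1 (hψ {x}).2 x (Finset.mem_singleton_self x)

end SimpleGraph

/-- The graph with vertex set `G` in which `g` and `k` are joined when the translates `g D` and
`k D` of the Dirichlet domain meet; it is the Cayley graph with respect to `faceSet G x₀`. -/
def dirichletGraph (G : Type v) {X : Type u} [Group G] [MetricSpace X] [MulAction G X] (x₀ : X) :
    SimpleGraph G where
  Adj g k := g ≠ k ∧ (g • dirichletDomain G x₀ ∩ k • dirichletDomain G x₀).Nonempty
  symm := ⟨fun g k h => ⟨h.1.symm, by rw [Set.inter_comm]; exact h.2⟩⟩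
  loopless := ⟨fun g h => h.1 rfl⟩

section Dirichlet

variable {G : Type v} {X : Type u} [Group G] [MetricSpace X] [MulAction G X] {x₀ : X}

theorem isEdgeChain_iff {A : Type*} [AddCommGroup A] {ψ : G → G → A} :
    IsEdgeChain x₀ ψ ↔ ψ ∈ (dirichletGraph G x₀).edgeChains A := Iff.rfl

theorem dirichletGraph_adj {g k : G} :
    (dirichletGraph G x₀).Adj g k ↔ g⁻¹ * k ∈ faceSet G x₀ := inv_mul_mem_faceSet_iff.symm

theorem IsEdgeChain.chainBoundary_eq_sum {A : Type*} [AddCommGroup A] [Fintype (faceSet G x₀)]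
    {ψ : G → G → A} (hψ : IsEdgeChain x₀ ψ) (g : G) :
    chainBoundary ψ g = ∑ s : faceSet G x₀, (ψ (g * s) g - ψ g (g * s)) := by
  have hinj : Function.Injective fun s : faceSet G x₀ => g * s :=
    (mul_right_injective g).comp Subtype.val_injective
  rw [chainBoundary, finsum_eq_sum_of_support_subset (s := Finset.univ.map ⟨_, hinj⟩),
    Finset.sum_map]
  · rfl
  · intro k hk
    have hadj : (dirichletGraph G x₀).Adj g k := by
      by_contra hn
      refine hk ?_
      have h1 := SimpleGraph.eq_zero_of_mem_edgeChains (isEdgeChain_iff.1 hψ) hn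
      have h2 := SimpleGraph.eq_zero_of_mem_edgeChains (isEdgeChain_iff.1 hψ)
        (mt (dirichletGraph G x₀).adj_symm hn)
      simp [h1, h2]
    simpa using ⟨g⁻¹ * k, dirichletGraph_adj.1 hadj, mul_inv_cancel_left g k⟩

variable [IsIsometricSMul G X]

namespace IsUniformOrbit

theorem finite_neighborSet_dirichletGraph (h : IsUniformOrbit G x₀) (g : G) :
    ((dirichletGraph G x₀).neighborSet g).Finite := by
  refine (h.finite_faceSet.image (g * ·)).subset fun k hk => ?_
  exact ⟨g⁻¹ * k, dirichletGraph_adj.1 hk, mul_inv_cancel_left g k⟩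

theorem preconnected_dirichletGraph [PreconnectedSpace X] (h : IsUniformOrbit G x₀) :
    (dirichletGraph G x₀).Preconnected := by
  have key : ∀ k ∈ Subgroup.closure (faceSet G x₀), ∀ g,
      (dirichletGraph G x₀).Reachable g (g * k) := by
    intro k hk
    induction hk using Subgroup.closure_induction with
    | mem s hs =>
      exact fun g => SimpleGraph.Adj.reachable (dirichletGraph_adj.2 (by simpa using hs))
    | one => exact fun g => by rw [mul_one]
    | mul a b _ _ ha hb => exact fun g => (ha g).trans (by simpa [mul_assoc] using hb (g * a))
    | inv a _ ha => exact fun g => by simpa using (ha (g * a⁻¹)).symm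
  intro g k
  simpa using key (g⁻¹ * k) (h.closure_faceSet ▸ Subgroup.mem_top _) g

end IsUniformOrbit

end Dirichlet

/-! ### Invariant chains with constant boundary -/

/-- Let `out g s` be the coefficient of a `1`-chain on the edge of the Cayley graph from `g` to
`g s`. If the chain is invariant under a subgroup `G'` of finite index and its boundary has the same
value `a` at each vertex, then `[G : G'] a = 0`: on the finite quotient of the Cayley graph by `G'`
the sum of the boundary over all vertices vanishes. -/
theorem Subgroup.index_nsmul_eq_zero_of_boundary_eq {G : Type*} [Group G] {A : Type*}
    [AddCommGroup A] (G' : Subgroup G) [G'.FiniteIndex] {S : Set G} [Fintype S]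
    (hS : ∀ s ∈ S, s⁻¹ ∈ S) (out : G → S → A) (hinv : ∀ k ∈ G', ∀ g, out (k * g) = out g) (a : A)
    (ha : ∀ g, ∑ s : S, (out (g * s) ⟨(s : G)⁻¹, hS s s.2⟩ - out g s) = a) :
    G'.index • a = 0 := by
  classical
  have : Fintype (G ⧸ G') := Fintype.ofFinite _
  -- the coset `x G'` in `G ⧸ G'` stands for the orbit `G' x⁻¹` of vertices
  let f : S → G ⧸ G' → A := fun s => Quotient.lift (fun x : G => out x⁻¹ s) (by
    intro x y hxy
    rw [← Quotient.eq_iff_equiv, Quotient.eq, QuotientGroup.leftRel_apply] at hxy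
    have := hinv _ (G'.inv_mem hxy) x⁻¹
    simp only [mul_inv_rev, inv_inv, mul_assoc, mul_inv_cancel, mul_one]
      at this
    exact (congrFun this s).symm)
  let ι : S ≃ S :=
    { toFun := fun s => ⟨(s : G)⁻¹, hS s s.2⟩
      invFun := fun s => ⟨(s : G)⁻¹, hS s s.2⟩
      left_inv := fun s => Subtype.ext (inv_inv _)
      right_inv := fun s => Subtype.ext (inv_inv _) }
  have h1 : ∀ c : G ⧸ G', ∑ s : S, (f (ι s) ((s : G)⁻¹ • c) - f s c) = a := by
    intro c
    induction c using QuotientGroup.induction_on with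
    | H x =>
      rw [← ha x⁻¹]
      refine Finset.sum_congr rfl fun s _ => ?_
      change out ((s : G)⁻¹ * x)⁻¹ _ - out x⁻¹ s = _
      rw [mul_inv_rev, inv_inv]
      rfl
  calc G'.index • a = ∑ c : G ⧸ G', ∑ s : S, (f (ι s) ((s : G)⁻¹ • c) - f s c) := by
        simp [h1, Subgroup.index, Nat.card_eq_fintype_card]
    _ = ∑ s : S, ∑ c : G ⧸ G', f (ι s) ((s : G)⁻¹ • c) - ∑ s : S, ∑ c : G ⧸ G', f s c := by
        rw [Finset.sum_comm]; simp only [Finset.sum_sub_distrib]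
    _ = ∑ s : S, ∑ c : G ⧸ G', f (ι s) c - ∑ s : S, ∑ c : G ⧸ G', f s c := by
        congr 1
        exact Finset.sum_congr rfl fun s _ =>
          Equiv.sum_comp (MulAction.toPerm ((s : G)⁻¹)) (f (ι s))
    _ = 0 := by rw [Equiv.sum_comp ι (fun s => ∑ c, f s c), sub_self]

/-! ### Tilings by the decorated tiles -/

section Tilings

variable {G : Type v} {X : Type u} [Group G] [MetricSpace X] [MulAction G X] {x₀ : X} {p : ℕ}
  {ψ : G → G → ZMod p}

/-- The tiling by the undecorated Dirichlet domain that underlies a tiling by decorated tiles. -/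
def Tiling.undecorate (T : Tiling (decoratedTiles x₀ ψ)) : Tiling (dirichletTile G x₀) where
  pieces := T.pieces
  sUnion_pieces := T.sUnion_pieces
  tile _ := PUnit.unit
  face P Q hne hPQ := (T.face P Q hne hPQ).2
  tileOf_face _ _ _ _ := rfl
  isometric P := T.isometric P
  opp_face P Q hne hPQ hne' hQP := congrArg Prod.fst (T.opp_face P Q hne hPQ hne' hQP)

/-- The pieces of `T` are the sets `u (g D)`, and the piece of `g` is indexed by `e g`, so that
the intersection of the pieces of `g` and `k` is identified with the face `W_{g⁻¹k}`. -/
structure Tiling.IsIndexedBy (T : Tiling (decoratedTiles x₀ ψ)) (u : X ≃ᵢ X)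
    (e : G ≃ T.pieces) : Prop where
  coe_eq : ∀ g, (e g : Set X) = u '' (g • dirichletDomain G x₀)
  face_eq : ∀ g k hne hgk, ((T.face (e g) (e k) hne hgk).2 : G) = g⁻¹ * k

theorem GridCondition.exists_isIndexedBy (hgrid : GridCondition G x₀)
    (T : Tiling (decoratedTiles x₀ ψ)) :
    ∃ (u : X ≃ᵢ X) (e : G ≃ T.pieces), T.IsIndexedBy u e := by
  obtain ⟨u, e, he, hf⟩ := hgrid.unique T.undecorate
  exact ⟨u, e, he, hf⟩

namespace Tiling.IsIndexedBy

variable {T : Tiling (decoratedTiles x₀ ψ)} {u : X ≃ᵢ X} {e : G ≃ T.pieces}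

theorem pieces_eq (h : T.IsIndexedBy u e) :
    T.pieces = Set.range fun g : G => u '' (g • dirichletDomain G x₀) := by
  ext P
  constructor
  · intro hP
    obtain ⟨g, hg⟩ := e.surjective ⟨P, hP⟩
    exact ⟨g, by simp only [← h.coe_eq, hg]⟩
  · rintro ⟨g, rfl⟩
    simp only [← h.coe_eq]
    exact (e g).2

theorem apply_ne_apply (_ : T.IsIndexedBy u e) {g : G} {s : G} (hs : s ∈ faceSet G x₀) :
    e g ≠ e (g * s) := by
  intro he
  have := e.injective he
  exact hs.1 (by simpa using this)

theorem inter_nonempty (h : T.IsIndexedBy u e) {g : G} {s : G} (hs : s ∈ faceSet G x₀) :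
    ((e g : Set X) ∩ e (g * s)).Nonempty := by
  rw [h.coe_eq, h.coe_eq, ← Set.image_inter u.injective, ← smul_dirichletFace]
  exact (hs.2.smul_set).image u

theorem face_snd_eq (h : T.IsIndexedBy u e) (P Q : T.pieces) (hne : P ≠ Q)
    (hPQ : ((P : Set X) ∩ Q).Nonempty) :
    ((T.face P Q hne hPQ).2 : G) = (e.symm P)⁻¹ * e.symm Q := by
  obtain ⟨g, rfl⟩ := e.surjective P
  obtain ⟨k, rfl⟩ := e.surjective Q
  simpa using h.face_eq g k hne hPQ

/-- The indentations on a face of the piece of `g` match the bumps of the neighbouring piece. -/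
theorem tile_apply_snd (h : T.IsIndexedBy u e) (g : G) (s : faceSet G x₀) :
    ((T.tile (e g)).1 s).2 = ((T.tile (e (g * s))).1 ⟨(s : G)⁻¹, inv_mem_faceSet s.2⟩).1 := by
  have hne := h.apply_ne_apply (g := g) s.2
  have hPQ := h.inter_nonempty (g := g) s.2
  have hQP : ((e (g * s) : Set X) ∩ e g).Nonempty := by rwa [Set.inter_comm]
  have hopp := congrArg (fun k => k.2.1) (T.opp_face _ _ hne hPQ hne.symm hQP)
  change ((T.face _ _ hne hPQ).1.1 (T.face _ _ hne hPQ).2).2 =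
    ((T.face _ _ hne.symm hQP).1.1 (T.face _ _ hne.symm hQP).2).1 at hopp
  have t1 : (T.face _ _ hne hPQ).1 = T.tile (e g) := T.tileOf_face _ _ hne hPQ
  have t2 : (T.face _ _ hne.symm hQP).1 = T.tile (e (g * s)) := T.tileOf_face _ _ hne.symm hQP
  have f1 : (T.face _ _ hne hPQ).2 = s := Subtype.ext (by
    rw [h.face_eq]; simp)
  have f2 : (T.face _ _ hne.symm hQP).2 = ⟨(s : G)⁻¹, inv_mem_faceSet s.2⟩ := Subtype.ext (by
    rw [h.face_eq]; simp)
  rwa [t1, t2, f1, f2] at hopp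

/-- The bumps and indentations of a tiling by the decorated tiles form a chain whose boundary agrees
at each vertex with the boundary of `ψ` at some vertex. -/
theorem sum_tile_sub_eq [Fintype (faceSet G x₀)] (h : T.IsIndexedBy u e)
    (hψ : IsEdgeChain x₀ ψ) {a : ZMod p} (ha : ∀ g, chainBoundary ψ g = a) (g : G) :
    ∑ s : faceSet G x₀, (((T.tile (e (g * s))).1 ⟨(s : G)⁻¹, inv_mem_faceSet s.2⟩).1 -
      ((T.tile (e g)).1 s).1) = a := by
  obtain ⟨k, hk⟩ := (T.tile (e g)).2
  rw [← ha k, hψ.chainBoundary_eq_sum]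
  refine Finset.sum_congr rfl fun s _ => ?_
  rw [← h.tile_apply_snd, ← hk]
  rfl

variable [IsIsometricSMul G X]

/-- An isometry that preserves the tiling acts on the pieces as a left translation of `G`: it
respects the kinds of faces, hence the edges of the Cayley graph together with their labels. -/
theorem exists_forall_image_eq [PreconnectedSpace X] (hx₀ : IsUniformOrbit G x₀)
    (h : T.IsIndexedBy u e) {γ : X ≃ᵢ X} (hγ : T.IsPreservedBy γ) :
    ∃ k : G, (∀ g : G, γ '' (u '' (g • dirichletDomain G x₀)) =
      u '' ((k * g) • dirichletDomain G x₀)) ∧ ∀ g, T.tile (e (k * g)) = T.tile (e g) := by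
  obtain ⟨σ, hσ, hσt, hσf⟩ := hγ
  let ρ : G → G := fun g => e.symm (σ (e g))
  have hs : ∀ s ∈ faceSet G x₀, ∀ g, ρ (g * s) = ρ g * s := by
    intro s hs g
    have hne := h.apply_ne_apply (g := g) hs
    have hPQ := h.inter_nonempty (g := g) hs
    have hne' : σ (e g) ≠ σ (e (g * s)) := fun he => hne (σ.injective he)
    have hPQ' : ((σ (e g) : Set X) ∩ σ (e (g * s))).Nonempty := by
      rw [hσ, hσ, ← Set.image_inter γ.injective]
      exact hPQ.image γ
    have hk : (T.face _ _ hne' hPQ').2 = (T.face _ _ hne hPQ).2 :=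
      congrArg Prod.fst (hσf _ _ hne hPQ hne' hPQ')
    have hk' := congrArg Subtype.val hk
    rw [h.face_snd_eq, h.face_eq, inv_mul_cancel_left, inv_mul_eq_iff_eq_mul] at hk'
    exact hk'
  have hall : ∀ k ∈ Subgroup.closure (faceSet G x₀), ∀ g, ρ (g * k) = ρ g * k := by
    intro k hk
    induction hk using Subgroup.closure_induction with
    | mem s h => exact hs s h
    | one => simp
    | mul a b _ _ ha hb => intro g; rw [← mul_assoc, hb, ha, mul_assoc]
    | inv a _ ha =>
      intro g
      rw [eq_mul_inv_iff_mul_eq, ← ha, inv_mul_cancel_right]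
  have hρ : ∀ g, σ (e g) = e (ρ 1 * g) := by
    intro g
    rw [← hall g (hx₀.closure_faceSet ▸ Subgroup.mem_top g) 1, one_mul]
    exact (e.apply_symm_apply _).symm
  refine ⟨ρ 1, fun g => ?_, fun g => ?_⟩
  · rw [← h.coe_eq, ← h.coe_eq, ← hρ, hσ]
  · rw [← hρ, hσt]

end Tiling.IsIndexedBy

/-- The group of those elements of `G` whose left translation of the sets `u (g D)` is induced by
an element of `Γ`. -/
def translationSubgroup (G : Type v) {X : Type u} [Group G] [MetricSpace X] [MulAction G X]
    (x₀ : X) (u : X ≃ᵢ X) (Γ : Subgroup (X ≃ᵢ X)) : Subgroup G where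
  carrier := {k | ∃ γ ∈ Γ, ∀ g : G, γ '' (u '' (g • dirichletDomain G x₀)) =
    u '' ((k * g) • dirichletDomain G x₀)}
  one_mem' := ⟨1, Γ.one_mem, fun g => by rw [one_mul]; exact Set.image_id _⟩
  mul_mem' := by
    rintro a b ⟨γ, hγ, ha⟩ ⟨δ, hδ, hb⟩
    refine ⟨γ * δ, Γ.mul_mem hγ hδ, fun g => ?_⟩
    rw [mul_assoc, ← ha, ← hb, ← Set.image_comp γ δ]
    rfl
  inv_mem' := by
    rintro a ⟨γ, hγ, ha⟩
    refine ⟨γ⁻¹, Γ.inv_mem hγ, fun g => ?_⟩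
    have := ha (a⁻¹ * g)
    rw [mul_inv_cancel_left] at this
    rw [← this, ← Set.image_comp]
    convert Set.image_id _
    ext x
    exact γ.symm_apply_apply x

namespace IsUniformOrbit

variable [IsIsometricSMul G X]

/-- A compact set meets only finitely many of the sets `u (g D)`, so that a cocompact group that
permutes these sets by left translations has finitely many orbits of them. -/
theorem finiteIndex_translationSubgroup (hx₀ : IsUniformOrbit G x₀) {u : X ≃ᵢ X}
    {Γ : Subgroup (X ≃ᵢ X)} (hΓ : ActsCocompactly Γ)
    (h : ∀ γ ∈ Γ, ∃ k : G, ∀ g : G, γ '' (u '' (g • dirichletDomain G x₀)) =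
      u '' ((k * g) • dirichletDomain G x₀)) :
    (translationSubgroup G x₀ u Γ).FiniteIndex := by
  obtain ⟨K, hK, hKΓ⟩ := hΓ
  have hfin := hx₀.finite_inter_nonempty (hK.image u.symm.continuous).isBounded
  have hrep : ∀ g : G, ∃ k ∈ translationSubgroup G x₀ u Γ,
      (u.symm '' K ∩ (k * g) • dirichletDomain G x₀).Nonempty := by
    intro g
    obtain ⟨γ, hγ, hγK⟩ := hKΓ (u (g • x₀))
    obtain ⟨k, hk⟩ := h γ hγ
    refine ⟨k, ⟨γ, hγ, hk⟩, u.symm (γ (u (g • x₀))), Set.mem_image_of_mem _ hγK, ?_⟩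
    have hmem : γ (u (g • x₀)) ∈ γ '' (u '' (g • dirichletDomain G x₀)) :=
      Set.mem_image_of_mem _ (Set.mem_image_of_mem _ (smul_mem_smul_dirichletDomain g))
    rw [hk g] at hmem
    obtain ⟨y, hy, hyu⟩ := hmem
    rwa [← hyu, u.symm_apply_apply]
  have := hfin.to_subtype
  have : Finite (G ⧸ translationSubgroup G x₀ u Γ) := by
    refine Finite.of_surjective
      (fun g : {g : G | (u.symm '' K ∩ g • dirichletDomain G x₀).Nonempty} =>
        QuotientGroup.mk (g : G)⁻¹) fun c => ?_
    induction c using QuotientGroup.induction_on with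
    | H x =>
      obtain ⟨k, hk, hkx⟩ := hrep x⁻¹
      exact ⟨⟨k * x⁻¹, hkx⟩, by simpa [QuotientGroup.eq] using hk⟩
  exact Subgroup.finiteIndex_of_finite_quotient

/-- The group `G'` is the group of the left translations of the pieces that are induced by `Γ`; the
chain formed by the decorations of the pieces is invariant under it. -/
theorem exists_finiteIndex_dvd_index [PreconnectedSpace X] (hx₀ : IsUniformOrbit G x₀)
    (hgrid : GridCondition G x₀) (hψ : IsEdgeChain x₀ ψ) (hb : ∀ g, chainBoundary ψ g = 1)
    (T : Tiling (decoratedTiles x₀ ψ)) (Γ : Subgroup (X ≃ᵢ X)) (hΓ : ActsCocompactly Γ)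
    (hT : ∀ γ ∈ Γ, T.IsPreservedBy γ) :
    ∃ (u : X ≃ᵢ X) (G' : Subgroup G),
      T.pieces = Set.range (fun g : G => u '' (g • dirichletDomain G x₀)) ∧
      (∀ γ ∈ Γ, ∃ k ∈ G', ∀ g : G, γ '' (u '' (g • dirichletDomain G x₀)) =
        u '' ((k * g) • dirichletDomain G x₀)) ∧
      (∀ k ∈ G', ∃ γ ∈ Γ, ∀ g : G, γ '' (u '' (g • dirichletDomain G x₀)) =
        u '' ((k * g) • dirichletDomain G x₀)) ∧
      G'.FiniteIndex ∧ p ∣ G'.index := by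
  obtain ⟨u, e, h⟩ := hgrid.exists_isIndexedBy T
  have hact := fun γ hγ => h.exists_forall_image_eq hx₀ (hT γ hγ)
  have hfi := hx₀.finiteIndex_translationSubgroup (u := u) hΓ
    fun γ hγ => (hact γ hγ).imp fun _ hk => hk.1
  refine ⟨u, translationSubgroup G x₀ u Γ, h.pieces_eq, fun γ hγ => ?_, fun k hk => hk, hfi, ?_⟩
  · obtain ⟨k, hk, -⟩ := hact γ hγ
    exact ⟨k, ⟨γ, hγ, hk⟩, hk⟩
  · have : Fintype (faceSet G x₀) := hx₀.finite_faceSet.fintype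
    have hinv : ∀ k ∈ translationSubgroup G x₀ u Γ, ∀ g, T.tile (e (k * g)) = T.tile (e g) := by
      rintro k ⟨γ, hγ, hk⟩ g
      obtain ⟨k', hk', ht⟩ := hact γ hγ
      have hkk' : k = k' := by
        have h1 := (hk 1).symm.trans (hk' 1)
        rw [mul_one, mul_one] at h1
        exact hx₀.smul_dirichletDomain_injective (u.injective.image_injective h1)
      rw [hkk', ht]
    have hz := (translationSubgroup G x₀ u Γ).index_nsmul_eq_zero_of_boundary_eq
      (fun s hs => inv_mem_faceSet hs) (fun g s => ((T.tile (e g)).1 s).1)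
      (fun k hk g => by simp only [hinv k hk g]) (1 : ZMod p) (h.sum_tile_sub_eq hψ hb)
    rwa [nsmul_one, ZMod.natCast_eq_zero_iff] at hz

end IsUniformOrbit

/-! ### The decorated tiles as a set of tiles -/

theorem exists_isometryEquiv_smul_set [IsIsometricSMul G X] (g : G) (A : Set X) :
    ∃ φ : A ≃ᵢ (g • A : Set X), ∀ y, (φ y : X) = g • (y : X) :=
  ⟨{ toFun := fun y => ⟨g • (y : X), Set.smul_mem_smul_set y.2⟩
     invFun := fun z => ⟨g⁻¹ • (z : X), Set.mem_smul_set_iff_inv_smul_mem.1 z.2⟩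
     left_inv := fun _ => Subtype.ext (inv_smul_smul _ _)
     right_inv := fun _ => Subtype.ext (smul_inv_smul _ _)
     isometry_toFun := fun y z => edist_smul_left g (y : X) z }, fun _ => rfl⟩

namespace IsUniformOrbit

theorem isSetOfTiles_decoratedTiles [NeZero p] [ProperSpace X] [IsIsometricSMul G X]
    (hx₀ : IsUniformOrbit G x₀) (hX : IsLengthSpace X) (hgrid : GridCondition G x₀) :
    (decoratedTiles x₀ ψ).IsSetOfTiles := by
  have : Finite (faceSet G x₀) := hx₀.finite_faceSet
  have htile : Finite (Set.range (decoration x₀ ψ)) := inferInstance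
  exact
    { finite_tile := htile
      finite_face := inferInstanceAs (Finite (Set.range (decoration x₀ ψ) × faceSet G x₀))
      finite_kind := inferInstanceAs (Finite (faceSet G x₀ × ZMod p × ZMod p))
      isCompact_shape := fun _ => hx₀.isCompact_dirichletDomain
      isConnected_shape := fun _ => hx₀.isConnected_dirichletDomain hX
      nonempty_interior_shape := fun _ => hx₀.interior_dirichletDomain_nonempty
      isClosed_carrier := fun f => isClosed_dirichletFace _
      isConnected_carrier := fun f => hgrid.isConnected_face _ f.2.2
      carrier_subset := fun f => Set.inter_subset_left
      congruent_of_kind_eq := by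
        rintro ⟨t, s⟩ ⟨t', s'⟩ h
        obtain rfl : s = s' := congrArg Prod.fst h
        exact ⟨IsometryEquiv.refl _⟩ }

/-- The translates of the Dirichlet domain, with the decorations given by `ψ`, form a tiling. -/
theorem nonempty_tiling_decoratedTiles [IsIsometricSMul G X] (hx₀ : IsUniformOrbit G x₀)
    (ψ : G → G → ZMod p) : Nonempty (Tiling (decoratedTiles x₀ ψ)) := by
  let e : G ≃ Set.range fun g : G => g • dirichletDomain G x₀ :=
    Equiv.ofInjective _ hx₀.smul_dirichletDomain_injective
  have he : ∀ P : Set.range fun g : G => g • dirichletDomain G x₀,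
      (P : Set X) = e.symm P • dirichletDomain G x₀ := fun P =>
    (Equiv.apply_ofInjective_symm hx₀.smul_dirichletDomain_injective P).symm
  have hs : ∀ P Q : Set.range fun g : G => g • dirichletDomain G x₀,
      P ≠ Q → ((P : Set X) ∩ Q).Nonempty → (e.symm P)⁻¹ * e.symm Q ∈ faceSet G x₀ := fun P Q hne hPQ =>
    inv_mul_mem_faceSet_iff.2 ⟨fun h => hne (e.symm.injective h), by rwa [← he, ← he]⟩
  refine ⟨{
    pieces := Set.range fun g : G => g • dirichletDomain G x₀
    sUnion_pieces := Set.eq_univ_of_forall fun x => ?_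
    tile := fun P => ⟨decoration x₀ ψ (e.symm P), Set.mem_range_self _⟩
    face := fun P Q hne hPQ => (⟨decoration x₀ ψ (e.symm P), Set.mem_range_self _⟩,
      ⟨(e.symm P)⁻¹ * e.symm Q, hs P Q hne hPQ⟩)
    tileOf_face := fun P Q hne hPQ => rfl
    isometric := fun P => ?_
    opp_face := fun P Q hne hPQ hne' hQP => ?_ }⟩
  · obtain ⟨g, hg⟩ := hx₀.exists_mem_smul_dirichletDomain x
    exact ⟨_, ⟨g, rfl⟩, hg⟩
  · obtain ⟨φ, hφ⟩ : ∃ φ : dirichletDomain G x₀ ≃ᵢ (P : Set X),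
        ∀ y, (φ y : X) = e.symm P • (y : X) := by
      rw [he P]
      simpa using exists_isometryEquiv_smul_set (e.symm P) (dirichletDomain G x₀)
    refine ⟨φ, fun Q hne hPQ => ?_⟩
    have hface : (P : Set X) ∩ Q =
        e.symm P • dirichletFace G x₀ ((e.symm P)⁻¹ * e.symm Q) := by
      rw [smul_dirichletFace, mul_inv_cancel_left, ← he, ← he]
    refine Eq.trans ?_ hface.symm
    ext x
    constructor
    · rintro ⟨y, hy, rfl⟩
      exact (congrArg (· ∈ _) (hφ y)).mpr (Set.smul_mem_smul_set hy)
    · rintro ⟨y, hy, rfl⟩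
      exact ⟨⟨y, hy.1⟩, hy, hφ _⟩
  · refine Prod.ext (Subtype.ext ?_) (Prod.ext ?_ ?_)
    · change ((e.symm P)⁻¹ * e.symm Q)⁻¹ = (e.symm Q)⁻¹ * e.symm P
      group
    · change ψ (e.symm P * ((e.symm P)⁻¹ * e.symm Q)) (e.symm P) =
        ψ (e.symm Q) (e.symm Q * ((e.symm Q)⁻¹ * e.symm P))
      rw [mul_inv_cancel_left, mul_inv_cancel_left]
    · change ψ (e.symm P) (e.symm P * ((e.symm P)⁻¹ * e.symm Q)) =
        ψ (e.symm Q * ((e.symm Q)⁻¹ * e.symm P)) (e.symm Q)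
      rw [mul_inv_cancel_left, mul_inv_cancel_left]

end IsUniformOrbit

end Tilings

/-! ### Aperiodic sets of tiles -/

theorem mainTheorem1
    {E : Type*} [NormedAddCommGroup E] [NormedSpace ℝ E] [FiniteDimensional ℝ E]
    {H : Type*} [TopologicalSpace H] (I : ModelWithCorners ℝ E H)
    -- the compact Riemannian manifold `M`
    {M : Type*} [MetricSpace M] [ChartedSpace H M] [IsManifold I ∞ M]
    [Bundle.RiemannianBundle (fun x : M => TangentSpace I x)]
    [IsContMDiffRiemannianBundle I ∞ E (fun x : M => TangentSpace I x)]
    [IsRiemannianManifold I M] [CompactSpace M]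
    -- the Riemannian manifold `X` that covers `M`
    {X : Type u} [MetricSpace X] [ChartedSpace H X] [IsManifold I ∞ X]
    [Bundle.RiemannianBundle (fun x : X => TangentSpace I x)]
    [IsContMDiffRiemannianBundle I ∞ E (fun x : X => TangentSpace I x)]
    [IsRiemannianManifold I X]
    -- the covering group `G`
    {G : Type v} [Group G] [Infinite G] [Group.FG G] [MulAction G X]
    (q : X → M) (hq : IsRegularMetricCovering G q)
    (x₀ : X) (hgrid : GridCondition G x₀)
    (p : ℕ) (hp : 0 < p) :
    -- there are chains `ψ` with boundary `∑ g`
    (∃ ψ : G → G → ZMod p, IsEdgeChain x₀ ψ ∧ ∀ g, chainBoundary ψ g = 1) ∧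
    ∀ ψ : G → G → ZMod p, IsEdgeChain x₀ ψ → (∀ g, chainBoundary ψ g = 1) →
      -- a cocompact symmetry group `Γ` of a tiling by the decorated tiles acts on the pieces as a
      -- subgroup `G'` of finite index in `G` with `[G : G'] ≡ 0` modulo `p`
      (∀ (T : Tiling (decoratedTiles x₀ ψ)) (Γ : Subgroup (X ≃ᵢ X)),
        ActsCocompactly Γ → (∀ γ ∈ Γ, T.IsPreservedBy γ) →
        ∃ (u : X ≃ᵢ X) (G' : Subgroup G),
          T.pieces = Set.range (fun g : G => u '' (g • dirichletDomain G x₀)) ∧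
          (∀ γ ∈ Γ, ∃ k ∈ G', ∀ g : G, γ '' (u '' (g • dirichletDomain G x₀)) =
            u '' ((k * g) • dirichletDomain G x₀)) ∧
          (∀ k ∈ G', ∃ γ ∈ Γ, ∀ g : G, γ '' (u '' (g • dirichletDomain G x₀)) =
            u '' ((k * g) • dirichletDomain G x₀)) ∧
          G'.FiniteIndex ∧ p ∣ G'.index) ∧
      -- if `p` divides no finite index, the decorated tiles are an aperiodic set of tiles
      ((∀ G' : Subgroup G, G'.FiniteIndex → ¬ p ∣ G'.index) →
        (decoratedTiles x₀ ψ).IsAperiodic) := by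
  have hX : IsLengthSpace X := IsRiemannianManifold.isLengthSpace I
  have : LocallyCompactSpace X := Manifold.locallyCompact_of_finiteDimensional I
  have : Nonempty X := ⟨x₀⟩
  have := hX.pathConnectedSpace
  have := hq.isIsometricSMul hX
  have := hq.properSpace hX
  have : NeZero p := ⟨hp.ne'⟩
  have hx₀ := hq.isUniformOrbit hX x₀
  refine ⟨?_, fun ψ hψ hb => ⟨?_, fun hindex => ?_⟩⟩
  · exact SimpleGraph.exists_chainBoundary_eq hx₀.finite_neighborSet_dirichletGraph
      hx₀.preconnected_dirichletGraph fun _ => 1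
  · exact hx₀.exists_finiteIndex_dvd_index hgrid hψ hb
  · refine ⟨hx₀.isSetOfTiles_decoratedTiles hX hgrid, hx₀.nonempty_tiling_decoratedTiles ψ, ?_⟩
    rintro T ⟨Γ, hΓ, hT⟩
    obtain ⟨-, G', -, -, -, hfi, hdvd⟩ :=
      hx₀.exists_finiteIndex_dvd_index hgrid hψ hb T Γ hΓ hT
    exact hindex G' hfi hdvd
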